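/- Let $n\ge 1$ and let $M_n$ be the space of complex $n\times n$ matrices. For $X\in M_n$ put $\operatorname{Re}(X)=\frac12(X+X^*)$ and let $W(X)=\{\langle Xx,x\rangle : x\in\mathbb C^n,\ \|x\|=1\}$ be its numerical range. For $\alpha\in[0,\pi/2)$ let $$S_\alpha=\{x+iy\in\mathbb C : x>0,\ |y|\le \tan(\alpha)\,x\},$$ and let $M^s_{n,\alpha}$ be the class of all $X\in M_n$ for which there is $z\in\mathbb C$ with $|z|=1$ and $W(zX)\subseteq S_\alpha$. Let $N$ be a norm on $M_n$ that is multiplicative ($N(XY)\le N(X)N(Y)$ for all $X,Y$), unitarily invariant ($N(UXV)=N(X)$ for all $X$ and all unitary $U,V$) and self-adjoint ($N(X^*)=N(X)$ for all $X$), and let $$\omega_N(X)=\sup_{\theta\in\mathbb R}N\bigl(\operatorname{Re}(e^{i\theta}X)\bigr).$$ Write $X\circ Y$ for the entrywise (Hadamard) product. **Theorem.** Let $\alpha_1,\alpha_2\in[0,\pi/2)$ and suppose $X=[x_{ij}]\in M^s_{n,\alpha_1}$ and $Y=[y_{ij}]\in M^s_{n,\alpha_2}$. Then $$\omega_N(X\circ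 Y)\le \sec(\alpha_1)\sec(\alpha_2)\,\max_j|x_{jj}|\;\omega_N(Y)$$ and $$\omega_N(X\circ Y)\le \sec(\alpha_1)\sec(\alpha_2)\,\max_j|y_{jj}|\;\omega_N(X);$$ consequently $$\omega_N(X\circ Y)\le \sec(\alpha_1)\sec(\alpha_2)\,\min\Bigl\{\max_j|x_{jj}|\;\omega_N(Y),\ \max_j|y_{jj}|\;\omega_N(X)\Bigr\}.$$ -/

import Mathlib

open scoped Matrix

noncomputable section

namespace SectorialMatrix

/-- The Hermitian part `Re X = (X + X*) / 2` of a complex matrix. -/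
def hermRe {n : ℕ} (X : Matrix (Fin n) (Fin n) ℂ) : Matrix (Fin n) (Fin n) ℂ :=
  (1 / 2 : ℂ) • (X + Xᴴ)

/-- The numerical range `W(X) = {⟨X x, x⟩ : ‖x‖ = 1}` for the Euclidean norm and the standard
inner product. Mathlib's `inner` is linear in its second argument, so `⟨X x, x⟩` is written
`inner ℂ x (X x)`. -/
def numericalRange {n : ℕ} (X : Matrix (Fin n) (Fin n) ℂ) : Set ℂ :=
  {c | ∃ x : EuclideanSpace ℂ (Fin n), ‖x‖ = 1 ∧ inner ℂ x (Matrix.toEuclideanLin X x) = c}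

/-- The sector `S_α = {x + i y : x > 0, |y| ≤ tan(α) x}`. -/
def sector (α : ℝ) : Set ℂ :=
  {c | 0 < c.re ∧ |c.im| ≤ Real.tan α * c.re}

/-- The class of `n × n` matrices `X` such that `W(z X) ⊆ S_α` for some complex number `z`
of modulus one; here `α` lies in `[0, π/2)`. -/
def sectorialClass (n : ℕ) (α : ℝ) : Set (Matrix (Fin n) (Fin n) ℂ) :=
  {X | 0 ≤ α ∧ α < Real.pi / 2 ∧ ∃ z : ℂ, ‖z‖ = 1 ∧ numericalRange (z • X) ⊆ sector α}

/-- A seminorm on the complex `n × n` matrices is a norm if it vanishes only at `0`. -/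
def IsNorm {n : ℕ} (N : Seminorm ℂ (Matrix (Fin n) (Fin n) ℂ)) : Prop :=
  ∀ X, N X = 0 → X = 0

/-- `N (X Y) ≤ N X * N Y` for all matrices. -/
def IsMultiplicative {n : ℕ} (N : Seminorm ℂ (Matrix (Fin n) (Fin n) ℂ)) : Prop :=
  ∀ X Y, N (X * Y) ≤ N X * N Y

/-- `N (U X V) = N X` for all matrices `X` and all unitary `U`, `V`. -/
def IsUnitarilyInvariant {n : ℕ} (N : Seminorm ℂ (Matrix (Fin n) (Fin n) ℂ)) : Prop :=
  ∀ X, ∀ U ∈ Matrix.unitaryGroup (Fin n) ℂ, ∀ V ∈ Matrix.unitaryGroup (Fin n) ℂ,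
    N (U * X * V) = N X

/-- `N X* = N X` for all matrices. -/
def IsSelfAdjointNorm {n : ℕ} (N : Seminorm ℂ (Matrix (Fin n) (Fin n) ℂ)) : Prop :=
  ∀ X, N Xᴴ = N X

/-- The generalized numerical radius `ω_N(X) = sup_θ N (Re (e^{iθ} X))`. -/
def genNumericalRadius {n : ℕ} (N : Seminorm ℂ (Matrix (Fin n) (Fin n) ℂ))
    (X : Matrix (Fin n) (Fin n) ℂ) : ℝ :=
  ⨆ θ : ℝ, N (hermRe (Complex.exp (Complex.I * (θ : ℂ)) • X))

/-- The supremum defining `ω_N(X)` is taken over a bounded set. -/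
theorem bddAbove_genNumericalRadius {n : ℕ} (N : Seminorm ℂ (Matrix (Fin n) (Fin n) ℂ))
    (X : Matrix (Fin n) (Fin n) ℂ) :
    BddAbove (Set.range fun θ : ℝ =>
      N (hermRe (Complex.exp (Complex.I * (θ : ℂ)) • X))) := by
  refine ⟨1 / 2 * (N X + N Xᴴ), ?_⟩
  rintro _ ⟨θ, rfl⟩
  have h1 : ‖Complex.exp (Complex.I * (θ : ℂ))‖ = 1 := by
    rw [mul_comm]; exact Complex.norm_exp_ofReal_mul_I θ
  have h2 := map_add_le_add N (Complex.exp (Complex.I * (θ : ℂ)) • X)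
    (Complex.exp (Complex.I * (θ : ℂ)) • X)ᴴ
  simp only [hermRe, map_smul_eq_mul, Matrix.conjTranspose_smul, norm_star, h1, one_mul] at h2 ⊢
  have h3 : ‖(1 / 2 : ℂ)‖ = 1 / 2 := by norm_num
  rw [h3]
  linarith

end SectorialMatrix

end

namespace SectorialMatrix

open Matrix
open scoped ComplexOrder

variable {n : ℕ} {N : Seminorm ℂ (Matrix (Fin n) (Fin n) ℂ)}

/-! Rotate `X` and `Y` so that their numerical ranges lie in the sectors. Each then has the form `c
• P + d • Q` with `P`, `Q` positive semidefinite, `P + Q` its Hermitian part and `‖c‖ = ‖d‖ = sec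
α`. Expanding the Hadamard product and applying the Schur product theorem bounds `|⟨(X ⊙ Y)u, u⟩|`
by `sec α₁ sec α₂ ⟨(A ⊙ B)u, u⟩`, where `A`, `B` are the Hermitian parts
(`norm_dotProduct_hadamard_mulVec_le`).

It remains to pass from quadratic forms to norms (`map_le_of_dotProduct_hadamard_le`). Evaluate at
an eigenbasis `u i` of `H = Re (e^{iθ} X ⊙ Y)` and expand `B` in its eigenbasis `w j`: the
eigenvalues satisfy `|h i| ≤ c ∑ j, T i j * b j`, where `T i j` is the form of `A` at `u i * conj (w
j)`. Orthonormality makes all row and column sums of `T` at most `m = max_j A j j`. So `T / m` lies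
below a doubly stochastic matrix, and Birkhoff's theorem with unitary invariance gives `N H ≤ c * m
* N B`. -/

/-- The diagonal complex matrix with a given real diagonal. -/
def realDiagonal (v : Fin n → ℝ) : Matrix (Fin n) (Fin n) ℂ :=
  diagonal fun i => (v i : ℂ)

/-! ### Unitarily invariant norms of real diagonal matrices -/

theorem diagonal_mem_unitaryGroup {d : Fin n → ℂ} (hd : ∀ i, ‖d i‖ = 1) :
    diagonal d ∈ unitaryGroup (Fin n) ℂ := by
  rw [mem_unitaryGroup_iff, star_eq_conjTranspose, diagonal_conjTranspose, diagonal_mul_diagonal,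
    ← diagonal_one]
  congr 1
  funext i
  simp [Complex.mul_conj, Complex.normSq_eq_norm_sq, hd i]

theorem IsUnitarilyInvariant.map_unitary_mul (hN : IsUnitarilyInvariant N)
    {U : Matrix (Fin n) (Fin n) ℂ} (hU : U ∈ unitaryGroup (Fin n) ℂ)
    (A : Matrix (Fin n) (Fin n) ℂ) : N (U * A) = N A := by
  simpa using hN A U hU 1 (one_mem _)

/-- A real diagonal contraction is the average of the two diagonal unitaries with entries `k ± i √(1
- k²)`. -/
theorem IsUnitarilyInvariant.map_realDiagonal_mul_le (hN : IsUnitarilyInvariant N)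
    {k : Fin n → ℝ} (hk : ∀ i, |k i| ≤ 1) (A : Matrix (Fin n) (Fin n) ℂ) :
    N (realDiagonal k * A) ≤ N A := by
  let s : Fin n → ℝ := fun i => Real.sqrt (1 - k i ^ 2)
  have hs : ∀ i, k i ^ 2 + s i ^ 2 = 1 := fun i => by
    have : k i ^ 2 ≤ 1 := (sq_le_one_iff_abs_le_one _).2 (hk i)
    rw [Real.sq_sqrt (by linarith)]
    ring
  let d : Fin n → ℂ := fun i => ⟨k i, s i⟩
  let e : Fin n → ℂ := fun i => ⟨k i, -s i⟩
  have hd : ∀ i, ‖d i‖ = 1 := fun i => by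
    rw [← sq_eq_sq₀ (norm_nonneg _) zero_le_one, ← Complex.normSq_eq_norm_sq, Complex.normSq_mk]
    linarith [hs i]
  have he : ∀ i, ‖e i‖ = 1 := fun i => by
    rw [← sq_eq_sq₀ (norm_nonneg _) zero_le_one, ← Complex.normSq_eq_norm_sq, Complex.normSq_mk]
    linarith [hs i]
  have hsplit : realDiagonal k * A =
      (1 / 2 : ℂ) • (diagonal d * A) + (1 / 2 : ℂ) • (diagonal e * A) := by
    rw [← smul_add, ← add_mul, diagonal_add, ← smul_mul_assoc, ← diagonal_smul]
    congr 1
    unfold realDiagonal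
    congr 1
    funext i
    apply Complex.ext <;> simp [d, e]
    ring
  have h12 : ‖(1 / 2 : ℂ)‖ = 1 / 2 := by norm_num
  have := map_add_le_add N ((1 / 2 : ℂ) • (diagonal d * A)) ((1 / 2 : ℂ) • (diagonal e * A))
  rw [map_smul_eq_mul, map_smul_eq_mul, hN.map_unitary_mul (diagonal_mem_unitaryGroup hd),
    hN.map_unitary_mul (diagonal_mem_unitaryGroup he), h12] at this
  rw [hsplit]
  linarith

theorem IsUnitarilyInvariant.map_realDiagonal_mono (hN : IsUnitarilyInvariant N)
    {a b : Fin n → ℝ} (hab : ∀ i, |a i| ≤ b i) :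
    N (realDiagonal a) ≤ N (realDiagonal b) := by
  have hb : ∀ i, 0 ≤ b i := fun i => (abs_nonneg _).trans (hab i)
  have h : realDiagonal a = realDiagonal (fun i => a i / b i) * realDiagonal b := by
    unfold realDiagonal
    rw [diagonal_mul_diagonal]
    congr 1
    funext i
    rw [← Complex.ofReal_mul]
    rcases eq_or_ne (b i) 0 with h0 | h0
    · have : a i = 0 := abs_nonpos_iff.1 (h0 ▸ hab i)
      simp [this]
    · rw [div_mul_cancel₀ _ h0]
  rw [h]
  refine hN.map_realDiagonal_mul_le (fun i => ?_) _
  rw [abs_div, abs_of_nonneg (hb i)]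
  exact div_le_one_of_le₀ (hab i) (hb i)

theorem permMatrix_mem_unitaryGroup (σ : Equiv.Perm (Fin n)) :
    σ.permMatrix ℂ ∈ unitaryGroup (Fin n) ℂ := by
  rw [mem_unitaryGroup_iff, star_eq_conjTranspose, conjTranspose_permMatrix, ← permMatrix_mul]
  simp

theorem IsUnitarilyInvariant.map_realDiagonal_perm (hN : IsUnitarilyInvariant N)
    (σ : Equiv.Perm (Fin n)) (b : Fin n → ℝ) :
    N (realDiagonal fun i => b (σ i)) = N (realDiagonal b) := by
  rw [← hN (realDiagonal b) _ (permMatrix_mem_unitaryGroup σ) _ (permMatrix_mem_unitaryGroup σ⁻¹)]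
  congr 1
  ext i j
  have hσ : (Equiv.symm σ⁻¹) j = σ j := rfl
  simp [realDiagonal, PEquiv.toMatrix_toPEquiv_mul, PEquiv.mul_toMatrix_toPEquiv,
    diagonal_apply, hσ]

/-- By Birkhoff, `S *ᵥ b` is a convex combination of permutations of `b`, all of which give the same
norm. -/
theorem IsUnitarilyInvariant.map_realDiagonal_mulVec_le (hN : IsUnitarilyInvariant N)
    {S : Matrix (Fin n) (Fin n) ℝ} (hS : S ∈ doublyStochastic ℝ (Fin n)) (b : Fin n → ℝ) :
    N (realDiagonal (S *ᵥ b)) ≤ N (realDiagonal b) := by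
  obtain ⟨w, hw, hw1, rfl⟩ := exists_eq_sum_perm_of_mem_doublyStochastic hS
  have h : realDiagonal ((∑ σ, w σ • Equiv.Perm.permMatrix ℝ σ) *ᵥ b) =
      ∑ σ : Equiv.Perm (Fin n), (w σ : ℂ) • realDiagonal fun i => b (σ i) := by
    ext i j
    rcases eq_or_ne i j with rfl | hij
    · simp [realDiagonal, sum_mulVec, smul_mulVec, permMatrix_mulVec, Matrix.sum_apply,
        Finset.sum_apply]
    · simp [realDiagonal, Matrix.sum_apply, hij]
  rw [h]
  refine (Finset.le_sum_of_subadditive N (map_zero N).le (map_add_le_add N) _ _).trans ?_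
  simp only [map_smul_eq_mul, hN.map_realDiagonal_perm, ← Finset.sum_mul]
  simp [abs_of_nonneg (hw _), hw1]

theorem exists_mem_doublyStochastic_ge {T : Matrix (Fin n) (Fin n) ℝ} (hT : ∀ i j, 0 ≤ T i j)
    (hrow : ∀ i, ∑ j, T i j ≤ 1) (hcol : ∀ j, ∑ i, T i j ≤ 1) :
    ∃ S ∈ doublyStochastic ℝ (Fin n), ∀ i j, T i j ≤ S i j := by
  let r : Fin n → ℝ := fun i => 1 - ∑ j, T i j
  let c : Fin n → ℝ := fun j => 1 - ∑ i, T i j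
  let s : ℝ := ∑ i, r i
  have hr : ∀ i, 0 ≤ r i := fun i => sub_nonneg.2 (hrow i)
  have hc : ∀ j, 0 ≤ c j := fun j => sub_nonneg.2 (hcol j)
  have hs : 0 ≤ s := Finset.sum_nonneg fun i _ => hr i
  have hsc : ∑ j, c j = s := by
    simp only [s, r, c, Finset.sum_sub_distrib]
    rw [Finset.sum_comm]
  have hr0 : s = 0 → ∀ i, r i = 0 := fun h i =>
    (Finset.sum_eq_zero_iff_of_nonneg fun i _ => hr i).1 h i (Finset.mem_univ i)
  have hc0 : s = 0 → ∀ j, c j = 0 := fun h j =>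
    (Finset.sum_eq_zero_iff_of_nonneg fun i _ => hc i).1 (hsc.trans h) j (Finset.mem_univ j)
  -- The row deficits `r` and column deficits `c` have the same total `s`, so the rank-one term `r i
  -- * c j / s` fills both. If `s = 0`, all deficits vanish and the division by zero is harmless.
  refine ⟨of fun i j => T i j + r i * c j / s, mem_doublyStochastic_iff_sum.2 ⟨?_, ?_, ?_⟩, ?_⟩
  · intro i j
    have := mul_nonneg (hr i) (hc j)
    have := hT i j
    rw [of_apply]
    positivity
  · intro i
    simp only [of_apply, Finset.sum_add_distrib, ← Finset.sum_div, ← Finset.mul_sum, hsc]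
    have : r i * s / s = r i := by
      rcases eq_or_ne s 0 with h | h
      · simp [hr0 h]
      · field_simp
    rw [this]
    simp [r]
  · intro j
    simp only [of_apply, Finset.sum_add_distrib, ← Finset.sum_div, ← Finset.sum_mul]
    have : s * c j / s = c j := by
      rcases eq_or_ne s 0 with h | h
      · simp [hc0 h]
      · field_simp
    rw [this]
    simp [c]
  · intro i j
    have := mul_nonneg (hr i) (hc j)
    rw [of_apply]
    exact le_add_of_nonneg_right (by positivity)

theorem IsUnitarilyInvariant.map_realDiagonal_le_of_substochastic (hN : IsUnitarilyInvariant N)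
    {T : Matrix (Fin n) (Fin n) ℝ} {m : ℝ} (hm : 0 ≤ m) (hT : ∀ i j, 0 ≤ T i j)
    (hrow : ∀ i, ∑ j, T i j ≤ m) (hcol : ∀ j, ∑ i, T i j ≤ m)
    {a b : Fin n → ℝ} (hb : ∀ j, 0 ≤ b j) {c : ℝ} (hc : 0 ≤ c)
    (hab : ∀ i, |a i| ≤ c * ∑ j, T i j * b j) :
    N (realDiagonal a) ≤ c * m * N (realDiagonal b) := by
  obtain ⟨S, hS, hTS⟩ := exists_mem_doublyStochastic_ge (T := m⁻¹ • T)
    (fun i j => mul_nonneg (inv_nonneg.2 hm) (hT i j))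
    (fun i => by
      simp only [Matrix.smul_apply, smul_eq_mul, ← Finset.mul_sum]
      exact (mul_le_mul_of_nonneg_left (hrow i) (inv_nonneg.2 hm)).trans inv_mul_le_one)
    (fun j => by
      simp only [Matrix.smul_apply, smul_eq_mul, ← Finset.mul_sum]
      exact (mul_le_mul_of_nonneg_left (hcol j) (inv_nonneg.2 hm)).trans inv_mul_le_one)
  -- If `m = 0`, the scaling by `m⁻¹ = 0` loses `T`, but the row sums then force `T i j ≤ 0`.
  have hTm : ∀ i j, T i j ≤ m * S i j := fun i j => by
    rcases hm.eq_or_lt with rfl | hm'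
    · rw [zero_mul]
      exact (Finset.single_le_sum (fun j _ => hT i j) (Finset.mem_univ j)).trans (hrow i)
    · have := hTS i j
      rwa [Matrix.smul_apply, smul_eq_mul, inv_mul_le_iff₀ hm'] at this
  have hdom : ∀ i, |a i| ≤ (c * m) * (S *ᵥ b) i := fun i => by
    refine (hab i).trans ?_
    rw [mul_assoc]
    refine mul_le_mul_of_nonneg_left ?_ hc
    simp only [mulVec, dotProduct, Finset.mul_sum, ← mul_assoc]
    exact Finset.sum_le_sum fun j _ => mul_le_mul_of_nonneg_right (hTm i j) (hb j)
  refine (hN.map_realDiagonal_mono hdom).trans ?_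
  have h : realDiagonal (fun i => (c * m) * (S *ᵥ b) i) =
      ((c * m : ℝ) : ℂ) • realDiagonal (S *ᵥ b) := by
    unfold realDiagonal
    rw [← diagonal_smul]
    congr 1
    funext i
    simp
  rw [h, map_smul_eq_mul, Complex.norm_real, Real.norm_of_nonneg (mul_nonneg hc hm)]
  exact mul_le_mul_of_nonneg_left (hN.map_realDiagonal_mulVec_le hS b) (mul_nonneg hc hm)

/-! ### Eigenbases and the quadratic form of a Hadamard product -/

theorem exists_eq_unitary_mul_realDiagonal_mul {H : Matrix (Fin n) (Fin n) ℂ}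
    (hH : H.IsHermitian) : ∃ U ∈ unitaryGroup (Fin n) ℂ,
      H = U * realDiagonal hH.eigenvalues * Uᴴ :=
  ⟨hH.eigenvectorUnitary, hH.eigenvectorUnitary.2, hH.spectral_theorem⟩

theorem dotProduct_mulVec_mul_eq_sum (A : Matrix (Fin n) (Fin n) ℂ) (v w : Fin n → ℂ) :
    star (v * w) ⬝ᵥ A *ᵥ (v * w) =
      ∑ p, ∑ q, star (v p) * v q * A p q * (w q * star (w p)) := by
  simp only [dotProduct, mulVec, Finset.mul_sum, Pi.star_apply, Pi.mul_apply, star_mul']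
  exact Finset.sum_congr rfl fun p _ => Finset.sum_congr rfl fun q _ => by ring

theorem sum_mul_star_row {V : Matrix (Fin n) (Fin n) ℂ} (hV : V ∈ unitaryGroup (Fin n) ℂ)
    (p q : Fin n) : ∑ j, V q j * star (V p j) = if p = q then 1 else 0 := by
  have h := congr_fun₂ (mem_unitaryGroup_iff.1 hV) q p
  simpa [mul_apply, one_apply, eq_comm] using h

theorem sum_norm_sq_col {U : Matrix (Fin n) (Fin n) ℂ} (hU : U ∈ unitaryGroup (Fin n) ℂ)
    (i : Fin n) : ∑ p, ‖U p i‖ ^ 2 = 1 := by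
  have h := congr_fun₂ (mem_unitaryGroup_iff'.1 hU) i i
  simp only [mul_apply, star_apply, one_apply_eq, RCLike.star_def, Complex.conj_mul'] at h
  exact_mod_cast h

/-- Summing over the orthonormal columns of `V` kills the off-diagonal entries of `A`, leaving an
average of its diagonal with weights `‖U p i‖ ^ 2`. -/
theorem sum_re_dotProduct_mulVec_mul_le {A U V : Matrix (Fin n) (Fin n) ℂ} {m : ℝ}
    (hA : ∀ j, (A j j).re ≤ m) (hU : U ∈ unitaryGroup (Fin n) ℂ)
    (hV : V ∈ unitaryGroup (Fin n) ℂ) (i : Fin n) :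
    ∑ j, (star (U.col i * V.col j) ⬝ᵥ A *ᵥ (U.col i * V.col j)).re ≤ m := by
  have h : ∑ j, star (U.col i * V.col j) ⬝ᵥ A *ᵥ (U.col i * V.col j) =
      ∑ p, ((‖U p i‖ ^ 2 : ℝ) : ℂ) * A p p := by
    simp only [dotProduct_mulVec_mul_eq_sum]
    rw [Finset.sum_comm]
    refine Finset.sum_congr rfl fun p _ => ?_
    rw [Finset.sum_comm]
    simp only [← Finset.mul_sum, col_apply, sum_mul_star_row hV]
    simp [Complex.conj_mul']
  rw [← Complex.re_sum, h, Complex.re_sum]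
  calc ∑ p, (((‖U p i‖ ^ 2 : ℝ) : ℂ) * A p p).re
      ≤ ∑ p, ‖U p i‖ ^ 2 * m := Finset.sum_le_sum fun p _ => by
        rw [Complex.re_ofReal_mul]
        exact mul_le_mul_of_nonneg_left (hA p) (by positivity)
    _ = m := by rw [← Finset.sum_mul, sum_norm_sq_col hU, one_mul]

theorem dotProduct_mulVec_col_eigen {H U : Matrix (Fin n) (Fin n) ℂ} {h : Fin n → ℝ}
    (hU : U ∈ unitaryGroup (Fin n) ℂ) (hH : H = U * realDiagonal h * Uᴴ) (i : Fin n) :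
    star (U.col i) ⬝ᵥ H *ᵥ U.col i = h i := by
  have h1 : Uᴴ * U = 1 := mem_unitaryGroup_iff'.1 hU
  have h2 : Uᴴ * H * U = realDiagonal h := by
    rw [hH, show Uᴴ * (U * realDiagonal h * Uᴴ) * U = (Uᴴ * U) * realDiagonal h * (Uᴴ * U) by
      simp only [Matrix.mul_assoc], h1, Matrix.one_mul, Matrix.mul_one]
  have h3 := congr_fun₂ h2 i i
  rw [Matrix.mul_assoc, mul_apply_eq_vecMul] at h3
  simpa [realDiagonal, dotProduct, mulVec, vecMul, mul_apply] using h3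

theorem dotProduct_hadamard_mulVec_eq_sum {A B W : Matrix (Fin n) (Fin n) ℂ} {b : Fin n → ℝ}
    (hB : B = W * realDiagonal b * Wᴴ) (u : Fin n → ℂ) :
    star u ⬝ᵥ (A ⊙ B) *ᵥ u = ∑ j,
      (star (u * (W.map star).col j) ⬝ᵥ A *ᵥ (u * (W.map star).col j)) * (b j : ℂ) := by
  have hBe : ∀ p q, B p q = ∑ j, star (W q j) * W p j * (b j : ℂ) := fun p q => by
    rw [hB, mul_apply]
    simp only [realDiagonal, mul_diagonal, conjTranspose_apply]
    exact Finset.sum_congr rfl fun j _ => by ring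
  simp only [dotProduct_mulVec_mul_eq_sum, Finset.sum_mul]
  rw [Finset.sum_comm]
  simp only [dotProduct, mulVec, Finset.mul_sum]
  refine Finset.sum_congr rfl fun p _ => ?_
  rw [Finset.sum_comm]
  refine Finset.sum_congr rfl fun q _ => ?_
  simp only [hadamard_apply, hBe, Finset.mul_sum, Finset.sum_mul, col_apply, map_apply, star_star,
    Pi.star_apply]
  exact Finset.sum_congr rfl fun j _ => by ring

/-- A Hermitian matrix whose quadratic form is dominated by that of `c • (A ⊙ B)`, with `A` and
`B` positive semidefinite, has norm at most `c * max_j (A j j) * N B`. -/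
theorem IsUnitarilyInvariant.map_le_of_dotProduct_hadamard_le (hN : IsUnitarilyInvariant N)
    {H A B : Matrix (Fin n) (Fin n) ℂ} (hH : H.IsHermitian) (hA : A.PosSemidef)
    (hB : B.PosSemidef) {c m : ℝ} (hc : 0 ≤ c) (hm : 0 ≤ m) (hAm : ∀ j, (A j j).re ≤ m)
    (hHAB : ∀ u, ‖star u ⬝ᵥ H *ᵥ u‖ ≤ c * (star u ⬝ᵥ (A ⊙ B) *ᵥ u).re) :
    N H ≤ c * m * N B := by
  obtain ⟨U, hU, hHU⟩ := exists_eq_unitary_mul_realDiagonal_mul hH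
  obtain ⟨W, hW, hBW⟩ := exists_eq_unitary_mul_realDiagonal_mul hB.1
  have hV := map_star_mem_unitaryGroup_iff.2 hW
  have hUs : Uᴴ ∈ unitaryGroup (Fin n) ℂ := Unitary.star_mem hU
  have hWs : Wᴴ ∈ unitaryGroup (Fin n) ℂ := Unitary.star_mem hW
  set V := W.map star with hVdef
  have hNH : N H = N (realDiagonal hH.eigenvalues) := by
    conv_lhs => rw [hHU]
    exact hN _ U hU _ hUs
  have hNB : N B = N (realDiagonal hB.1.eigenvalues) := by
    conv_lhs => rw [hBW]
    exact hN _ W hW _ hWs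
  rw [hNH, hNB]
  refine hN.map_realDiagonal_le_of_substochastic
    (T := of fun i j => (star (U.col i * V.col j) ⬝ᵥ A *ᵥ (U.col i * V.col j)).re)
    hm (fun i j => (Complex.nonneg_iff.1 (hA.dotProduct_mulVec_nonneg _)).1)
    (fun i => sum_re_dotProduct_mulVec_mul_le hAm hU hV i)
    (fun j => ?_) hB.eigenvalues_nonneg hc (fun i => ?_)
  -- The entrywise product is symmetric in `U` and `V`, so column sums are row sums with the roles
  -- exchanged.
  · simpa only [of_apply, mul_comm] using sum_re_dotProduct_mulVec_mul_le hAm hV hU j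
  · have h := hHAB (U.col i)
    rw [dotProduct_mulVec_col_eigen hU hHU, dotProduct_hadamard_mulVec_eq_sum hBW,
      Complex.norm_real, Real.norm_eq_abs, Complex.re_sum] at h
    simpa only [Complex.re_mul_ofReal, of_apply, hVdef] using h

/-! ### Hermitian parts and the decomposition of sectorial matrices -/

/-- The skew part `(X - X*) / (2 i)` of a complex matrix. -/
noncomputable def hermIm (X : Matrix (Fin n) (Fin n) ℂ) : Matrix (Fin n) (Fin n) ℂ :=
  (-Complex.I / 2 : ℂ) • (X - Xᴴ)

theorem isHermitian_hermRe (X : Matrix (Fin n) (Fin n) ℂ) : (hermRe X).IsHermitian := by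
  simp [hermRe, IsHermitian, conjTranspose_smul, add_comm]

theorem isHermitian_hermIm (X : Matrix (Fin n) (Fin n) ℂ) : (hermIm X).IsHermitian := by
  rw [IsHermitian, hermIm, conjTranspose_smul, conjTranspose_sub, conjTranspose_conjTranspose,
    ← neg_sub X, smul_neg, ← neg_smul]
  congr 1
  simp [neg_div]

theorem hermRe_add_I_smul_hermIm (X : Matrix (Fin n) (Fin n) ℂ) :
    hermRe X + Complex.I • hermIm X = X := by
  have h : Complex.I * (-Complex.I / 2) = 1 / 2 := by
    linear_combination (-1 / 2 : ℂ) * Complex.I_mul_I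
  rw [hermRe, hermIm, smul_smul, h, ← smul_add, add_add_sub_cancel, ← two_smul ℂ, smul_smul]
  norm_num

theorem dotProduct_conjTranspose_mulVec (X : Matrix (Fin n) (Fin n) ℂ) (u : Fin n → ℂ) :
    star u ⬝ᵥ Xᴴ *ᵥ u = star (star u ⬝ᵥ X *ᵥ u) := by
  rw [star_dotProduct, star_mulVec, ← dotProduct_mulVec, conjTranspose_conjTranspose]

theorem dotProduct_hermRe_mulVec (X : Matrix (Fin n) (Fin n) ℂ) (u : Fin n → ℂ) :
    star u ⬝ᵥ hermRe X *ᵥ u = ((star u ⬝ᵥ X *ᵥ u).re : ℂ) := by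
  rw [hermRe, smul_mulVec, add_mulVec, dotProduct_smul, dotProduct_add,
    dotProduct_conjTranspose_mulVec, Complex.re_eq_add_conj, smul_eq_mul, RCLike.star_def]
  ring

theorem dotProduct_hermIm_mulVec (X : Matrix (Fin n) (Fin n) ℂ) (u : Fin n → ℂ) :
    star u ⬝ᵥ hermIm X *ᵥ u = ((star u ⬝ᵥ X *ᵥ u).im : ℂ) := by
  rw [hermIm, smul_mulVec, sub_mulVec, dotProduct_smul, dotProduct_sub,
    dotProduct_conjTranspose_mulVec, Complex.im_eq_sub_conj, smul_eq_mul, RCLike.star_def,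
    mul_comm (2 : ℂ), ← div_div, Complex.div_I]
  ring

theorem eq_zero_of_dotProduct_mulVec_eq_zero {H : Matrix (Fin n) (Fin n) ℂ}
    (hH : H.IsHermitian) (h : ∀ u, star u ⬝ᵥ H *ᵥ u = 0) : H = 0 := by
  obtain ⟨U, hU, hHU⟩ := exists_eq_unitary_mul_realDiagonal_mul hH
  refine hH.eigenvalues_eq_zero_iff.1 (funext fun i => ?_)
  have := dotProduct_mulVec_col_eigen hU hHU i
  rw [h] at this
  exact_mod_cast this.symm

/-- Scaling extends the sector condition from unit vectors to all `u`; including `u = 0` weakens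
strict positivity. -/
theorem mem_sector_of_numericalRange_subset {X : Matrix (Fin n) (Fin n) ℂ} {α : ℝ}
    (hX : numericalRange X ⊆ sector α) (u : Fin n → ℂ) :
    0 ≤ (star u ⬝ᵥ X *ᵥ u).re ∧
      |(star u ⬝ᵥ X *ᵥ u).im| ≤ Real.tan α * (star u ⬝ᵥ X *ᵥ u).re := by
  rcases eq_or_ne u 0 with rfl | hu
  · simp
  set x : EuclideanSpace ℂ (Fin n) := WithLp.toLp 2 u with hx
  have hx0 : x ≠ 0 := fun h => hu (by simpa [hx] using h)
  have hpos : 0 < ‖x‖ := norm_pos_iff.2 hx0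
  set r : ℝ := ‖x‖⁻¹ with hr
  have hrpos : 0 < r := inv_pos.2 hpos
  have hmem : ((r ^ 2 : ℝ) : ℂ) * (star u ⬝ᵥ X *ᵥ u) ∈ sector α := by
    apply hX
    refine ⟨(r : ℂ) • x, ?_, ?_⟩
    · rw [norm_smul, Complex.norm_real, Real.norm_of_nonneg hrpos.le, hr,
        inv_mul_cancel₀ hpos.ne']
    · rw [map_smul, inner_smul_left, inner_smul_right, EuclideanSpace.inner_eq_star_dotProduct,
        Matrix.toLpLin_apply, dotProduct_comm]
      simp [hx]
      ring
  obtain ⟨h1, h2⟩ := hmem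
  have hr2 : 0 < r ^ 2 := by positivity
  rw [Complex.re_ofReal_mul] at h1 h2
  rw [Complex.im_ofReal_mul, abs_mul, abs_of_pos hr2, mul_left_comm] at h2
  exact ⟨(pos_of_mul_pos_right h1 hr2.le).le, le_of_mul_le_mul_left h2 hr2⟩

theorem norm_one_add_tan_mul_I {α : ℝ} (h : 0 < Real.cos α) :
    ‖(⟨1, Real.tan α⟩ : ℂ)‖ = (Real.cos α)⁻¹ := by
  rw [← sq_eq_sq₀ (norm_nonneg _) (inv_nonneg.2 h.le), ← Complex.normSq_eq_norm_sq,
    Complex.normSq_mk, Real.tan_eq_sin_div_cos]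
  have := Real.sin_sq_add_cos_sq α
  field_simp
  linarith

/-- A sectorial matrix is a combination of two positive semidefinite matrices with sum `Re X`
and complex coefficients of modulus `sec α`. -/
theorem exists_posSemidef_decomposition {X : Matrix (Fin n) (Fin n) ℂ} {α : ℝ} (hα : 0 ≤ α)
    (hα' : α < Real.pi / 2) (hX : numericalRange X ⊆ sector α) :
    ∃ P Q : Matrix (Fin n) (Fin n) ℂ, P.PosSemidef ∧ Q.PosSemidef ∧ hermRe X = P + Q ∧
      ∃ c d : ℂ, ‖c‖ = (Real.cos α)⁻¹ ∧ ‖d‖ = (Real.cos α)⁻¹ ∧ X = c • P + d • Q := by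
  have hcos : 0 < Real.cos α := Real.cos_pos_of_mem_Ioo ⟨by linarith [Real.pi_pos], hα'⟩
  set t : ℝ := Real.tan α with ht
  have ht0 : 0 ≤ t := Real.tan_nonneg_of_nonneg_of_le_pi_div_two hα hα'.le
  have hsec := mem_sector_of_numericalRange_subset hX
  -- Covers `α = 0` too: there `t⁻¹ = 0`, and the sector condition forces `hermIm X = 0`.
  have hS : ((t : ℂ) * (t : ℂ)⁻¹) • hermIm X = hermIm X := by
    rcases ht0.eq_or_lt with h | h
    · suffices hermIm X = 0 by simp [this]
      refine eq_zero_of_dotProduct_mulVec_eq_zero (isHermitian_hermIm X) fun u => ?_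
      have := (hsec u).2
      rw [← ht, ← h, zero_mul, abs_nonpos_iff] at this
      rw [dotProduct_hermIm_mulVec, this, Complex.ofReal_zero]
    · rw [mul_inv_cancel₀ (by exact_mod_cast h.ne'), one_smul]
  have hpsd : ∀ s : ℝ, |s| = t⁻¹ →
      ((1 / 2 : ℝ) • (hermRe X + s • hermIm X)).PosSemidef := fun s hs => by
    refine PosSemidef.smul (PosSemidef.of_dotProduct_mulVec_nonneg ?_ fun u => ?_) (by norm_num)
    · exact (isHermitian_hermRe X).add (by
        rw [IsHermitian, conjTranspose_smul, isHermitian_hermIm X, star_trivial])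
    · rw [add_mulVec, smul_mulVec, dotProduct_add, dotProduct_smul, dotProduct_hermRe_mulVec,
        dotProduct_hermIm_mulVec, Complex.real_smul, ← Complex.ofReal_mul, ← Complex.ofReal_add]
      refine Complex.zero_le_real.2 ?_
      obtain ⟨h1, h2⟩ := hsec u
      set a := (star u ⬝ᵥ X *ᵥ u).re
      set b := (star u ⬝ᵥ X *ᵥ u).im
      have h3 : |s * b| ≤ a := by
        rw [abs_mul, hs]
        calc t⁻¹ * |b| ≤ t⁻¹ * (t * a) := mul_le_mul_of_nonneg_left h2 (inv_nonneg.2 ht0)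
          _ = t⁻¹ * t * a := by ring
          _ ≤ 1 * a := mul_le_mul_of_nonneg_right inv_mul_le_one h1
          _ = a := one_mul a
      linarith [neg_abs_le (s * b)]
  have hsum : (1 / 2 : ℝ) • (hermRe X + t⁻¹ • hermIm X) +
      (1 / 2 : ℝ) • (hermRe X + (-t⁻¹) • hermIm X) = hermRe X := by
    module
  -- `P, Q = (Re X ± t⁻¹ Im X) / 2` with coefficients `1 ± i t`, where `t = tan α`.
  refine ⟨_, _, hpsd t⁻¹ (abs_of_nonneg (inv_nonneg.2 ht0)),
    hpsd (-t⁻¹) (by rw [abs_neg, abs_of_nonneg (inv_nonneg.2 ht0)]), hsum.symm,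
    ⟨1, t⟩, ⟨1, -t⟩, norm_one_add_tan_mul_I hcos, ?_, ?_⟩
  · rw [ht, ← Real.tan_neg, norm_one_add_tan_mul_I (by rwa [Real.cos_neg]), Real.cos_neg]
  · have e1 : (⟨1, t⟩ : ℂ) = 1 + t * Complex.I := by apply Complex.ext <;> simp
    have e2 : (⟨1, -t⟩ : ℂ) = 1 - t * Complex.I := by apply Complex.ext <;> simp
    conv_lhs => rw [← hermRe_add_I_smul_hermIm X, ← hS]
    rw [e1, e2]
    ext i j
    simp
    ring

/-- The quadratic form of a Hadamard product of sectorial matrices is controlled by that of the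
Hadamard product of their Hermitian parts. -/
theorem norm_dotProduct_hadamard_mulVec_le {X Y : Matrix (Fin n) (Fin n) ℂ} {α β : ℝ}
    (hα : 0 ≤ α) (hα' : α < Real.pi / 2) (hβ : 0 ≤ β) (hβ' : β < Real.pi / 2)
    (hX : numericalRange X ⊆ sector α) (hY : numericalRange Y ⊆ sector β) (u : Fin n → ℂ) :
    ‖star u ⬝ᵥ (X ⊙ Y) *ᵥ u‖ ≤ (Real.cos α)⁻¹ * (Real.cos β)⁻¹ *
      (star u ⬝ᵥ (hermRe X ⊙ hermRe Y) *ᵥ u).re := by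
  obtain ⟨P, Q, hP, hQ, hR, c, d, hc, hd, hXe⟩ := exists_posSemidef_decomposition hα hα' hX
  obtain ⟨P', Q', hP', hQ', hR', c', d', hc', hd', hYe⟩ :=
    exists_posSemidef_decomposition hβ hβ' hY
  have key : ∀ {A B : Matrix (Fin n) (Fin n) ℂ} {z w : ℂ}, A.PosSemidef → B.PosSemidef →
      ‖z‖ = (Real.cos α)⁻¹ → ‖w‖ = (Real.cos β)⁻¹ →
      ‖z * w * (star u ⬝ᵥ (A ⊙ B) *ᵥ u)‖ =
        (Real.cos α)⁻¹ * (Real.cos β)⁻¹ * (star u ⬝ᵥ (A ⊙ B) *ᵥ u).re := by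
    intro A B z w hA hB hz hw
    have h := (hA.hadamard hB).dotProduct_mulVec_nonneg u
    rw [norm_mul, norm_mul, hz, hw]
    congr 1
    exact congrArg Complex.re (Complex.norm_of_nonneg' h)
  have hq : star u ⬝ᵥ (X ⊙ Y) *ᵥ u =
      c * c' * (star u ⬝ᵥ (P ⊙ P') *ᵥ u) + c * d' * (star u ⬝ᵥ (P ⊙ Q') *ᵥ u) +
      d * c' * (star u ⬝ᵥ (Q ⊙ P') *ᵥ u) + d * d' * (star u ⬝ᵥ (Q ⊙ Q') *ᵥ u) := by
    rw [hXe, hYe]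
    simp only [add_hadamard, hadamard_add, smul_hadamard, hadamard_smul, add_mulVec, smul_mulVec,
      dotProduct_add, dotProduct_smul, smul_eq_mul]
    ring
  rw [hq, hR, hR']
  simp only [add_hadamard, hadamard_add, add_mulVec, dotProduct_add, Complex.add_re]
  -- After the triangle inequality nothing is lost: all four coefficients have the same modulus and
  -- each form is nonnegative.
  refine (norm_add₄_le).trans (le_of_eq ?_)
  rw [key hP hP' hc hc', key hP hQ' hc hd', key hQ hP' hd hc', key hQ hQ' hd hd']
  ring

theorem posSemidef_hermRe {X : Matrix (Fin n) (Fin n) ℂ} {α : ℝ}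
    (hX : numericalRange X ⊆ sector α) : (hermRe X).PosSemidef :=
  PosSemidef.of_dotProduct_mulVec_nonneg (isHermitian_hermRe X) fun u => by
    rw [dotProduct_hermRe_mulVec]
    exact Complex.zero_le_real.2 (mem_sector_of_numericalRange_subset hX u).1

/-! ### Rotations and the generalized numerical radius -/

theorem map_hermRe_smul_le_genNumericalRadius (N : Seminorm ℂ (Matrix (Fin n) (Fin n) ℂ))
    (X : Matrix (Fin n) (Fin n) ℂ) {z : ℂ} (hz : ‖z‖ = 1) :
    N (hermRe (z • X)) ≤ genNumericalRadius N X := by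
  have h : Complex.exp (Complex.I * (z.arg : ℂ)) = z := by
    have := Complex.norm_mul_exp_arg_mul_I z
    rwa [hz, Complex.ofReal_one, one_mul, mul_comm] at this
  have := le_ciSup (bddAbove_genNumericalRadius N X) z.arg
  rwa [h] at this

theorem genNumericalRadius_hadamard_le (hN : IsUnitarilyInvariant N) {α₁ α₂ : ℝ}
    {X Y : Matrix (Fin n) (Fin n) ℂ} (hX : X ∈ sectorialClass n α₁)
    (hY : Y ∈ sectorialClass n α₂) :
    genNumericalRadius N (X ⊙ Y) ≤
      (Real.cos α₁)⁻¹ * (Real.cos α₂)⁻¹ * ((⨆ j, ‖X j j‖) * genNumericalRadius N Y) := by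
  obtain ⟨h1, h1', z, hz, hzX⟩ := hX
  obtain ⟨h2, h2', w, hw, hwY⟩ := hY
  have hc1 : 0 < Real.cos α₁ := Real.cos_pos_of_mem_Ioo ⟨by linarith [Real.pi_pos], h1'⟩
  have hc2 : 0 < Real.cos α₂ := Real.cos_pos_of_mem_Ioo ⟨by linarith [Real.pi_pos], h2'⟩
  have hc : 0 ≤ (Real.cos α₁)⁻¹ * (Real.cos α₂)⁻¹ := by positivity
  have hm : 0 ≤ ⨆ j, ‖X j j‖ := Real.iSup_nonneg fun j => norm_nonneg _
  refine ciSup_le fun θ => ?_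
  set e := Complex.exp (Complex.I * (θ : ℂ)) with he
  have he1 : ‖e‖ = 1 := by
    rw [he, mul_comm]
    exact Complex.norm_exp_ofReal_mul_I θ
  have hbound : N (hermRe (e • (X ⊙ Y))) ≤
      (Real.cos α₁)⁻¹ * (Real.cos α₂)⁻¹ * (⨆ j, ‖X j j‖) * N (hermRe (w • Y)) := by
    refine hN.map_le_of_dotProduct_hadamard_le (isHermitian_hermRe _) (posSemidef_hermRe hzX)
      (posSemidef_hermRe hwY) hc hm (fun j => ?_) (fun u => ?_)
    · have hre : (hermRe (z • X) j j).re = (z * X j j).re := by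
        simp [hermRe]
        ring
      rw [hre]
      refine (Complex.re_le_norm _).trans ?_
      rw [norm_mul, hz, one_mul]
      exact le_ciSup (f := fun j => ‖X j j‖) (Set.finite_range _).bddAbove j
    · refine le_trans ?_ (norm_dotProduct_hadamard_mulVec_le h1 h1' h2 h2' hzX hwY u)
      rw [dotProduct_hermRe_mulVec, Complex.norm_real]
      refine (Complex.abs_re_le_norm _).trans (le_of_eq ?_)
      -- The unimodular factors `e`, `z`, `w` do not change the modulus of the form, so one bound
      -- serves every `θ`.
      simp only [smul_hadamard, hadamard_smul, smul_mulVec, dotProduct_smul, norm_smul, he1, hz, hw,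
        one_mul]
  refine hbound.trans ?_
  rw [mul_assoc]
  exact mul_le_mul_of_nonneg_left (mul_le_mul_of_nonneg_left
    (map_hermRe_smul_le_genNumericalRadius N Y hw) hm) hc

end SectorialMatrix

theorem mainTheorem3 {n : ℕ} (hn : 1 ≤ n)
    (N : Seminorm ℂ (Matrix (Fin n) (Fin n) ℂ))
    (hN : SectorialMatrix.IsNorm N)
    (hmul : SectorialMatrix.IsMultiplicative N)
    (hunit : SectorialMatrix.IsUnitarilyInvariant N)
    (hadj : SectorialMatrix.IsSelfAdjointNorm N)
    {α₁ α₂ : ℝ} (X Y : Matrix (Fin n) (Fin n) ℂ)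
    (hX : X ∈ SectorialMatrix.sectorialClass n α₁)
    (hY : Y ∈ SectorialMatrix.sectorialClass n α₂) :
    SectorialMatrix.genNumericalRadius N (X ⊙ Y) ≤
        (Real.cos α₁)⁻¹ * (Real.cos α₂)⁻¹ *
          ((⨆ j : Fin n, ‖X j j‖) * SectorialMatrix.genNumericalRadius N Y) ∧
      SectorialMatrix.genNumericalRadius N (X ⊙ Y) ≤
        (Real.cos α₁)⁻¹ * (Real.cos α₂)⁻¹ *
          ((⨆ j : Fin n, ‖Y j j‖) * SectorialMatrix.genNumericalRadius N X) ∧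
      SectorialMatrix.genNumericalRadius N (X ⊙ Y) ≤
        (Real.cos α₁)⁻¹ * (Real.cos α₂)⁻¹ *
          min ((⨆ j : Fin n, ‖X j j‖) * SectorialMatrix.genNumericalRadius N Y)
            ((⨆ j : Fin n, ‖Y j j‖) * SectorialMatrix.genNumericalRadius N X) := by
  have h1 := SectorialMatrix.genNumericalRadius_hadamard_le hunit hX hY
  have h2 := SectorialMatrix.genNumericalRadius_hadamard_le hunit hY hX
  rw [Matrix.hadamard_comm, mul_comm (Real.cos α₂)⁻¹] at h2
  refine ⟨h1, h2, ?_⟩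
  rcases min_choice ((⨆ j : Fin n, ‖X j j‖) * SectorialMatrix.genNumericalRadius N Y)
    ((⨆ j : Fin n, ‖Y j j‖) * SectorialMatrix.genNumericalRadius N X) with h | h <;> rw [h]
  exacts [h1, h2]
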